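/- Consider a cascade of two bimodal switched systems $$\text{I}:\ \dot\xi_1=\begin{cases}f_{11}(\xi_1,t), & H_1(\xi_1)>0\\ f_{12}(\xi_1,t), & H_1(\xi_1)<0,\end{cases}\qquad \text{II}:\ \dot\xi_2=\begin{cases}f_{21}(\xi_1,\xi_2,t), & H_2(\xi_2)>0\\ f_{22}(\xi_1,\xi_2,t), & H_2(\xi_2)<0,\end{cases}$$ with $\xi_1\in\mathbb R^{n_1}$, $\xi_2\in\mathbb R^{n_2}$, $t\ge 0$, where for each $t$ the modes are continuously differentiable in the state, $H_1,H_2$ are real-valued and continuously differentiable, and $\nabla H_i\neq0$ on $\{H_i=0\}$. Solutions are understood in the sense of Filippov: they are absolutely continuous on compact intervals of $[0,\infty)$, and for almost every $t$ the derivative of each $\xi_i$ is given by the active mode of system $i$ or, if $H_i(\xi_i)=0$, is a convex combination of the two modes of system $i$. Fix any norms on $\mathbb R^{n_1}$ and $\mathbb R^{n_2}$; $\|A\|$ is the induced operator norm and $\mu(A)=\limsup_{h\to0^+}(\|I+hA\|-1)/h$ the induced matrix measure. Suppose there are constants $q_1,q_2,\tilde c_1,\tilde c_2>0$ such that, for all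 $\xi_1\in\mathbb R^{n_1}$, $\xi_2\in\mathbb R^{n_2}$ and $t\ge0$: 1) $\mu\big(\tfrac{\partial f_{21}}{\partial\xi_2}(\xi_1,\xi_2,t)\big)\le -q_1$ if $H_2(\xi_2)>0$, and $\mu\big(\tfrac{\partial f_{22}}{\partial\xi_2}(\xi_1,\xi_2,t)\big)\le -q_2$ if $H_2(\xi_2)<0$; 2) $\mu\big[(f_{21}-f_{22})(\xi_1,\xi_2,t)\,\nabla H_2(\xi_2)\big]=0$ if $H_2(\xi_2)=0$, where $\nabla H_2$ is a row vector; 3) $\big\|\tfrac{\partial f_{21}}{\partial\xi_1}(\xi_1,\xi_2,t)\big\|\le\tilde c_1$ if $H_2(\xi_2)>0$, and $\big\|\tfrac{\partial f_{22}}{\partial\xi_1}(\xi_1,\xi_2,t)\big\|\le\tilde c_2$ if $H_2(\xi_2)<0$. Suppose further that system I is contracting with rate $p>0$, in either of the following senses: (a) system I is incrementally exponentially stable with rate $p$, i.e. there is $k>0$ with $\|\xi_1(t)-\xi_1'(t)\|\le k e^{-pt}\|\xi_1(0)-\xi_1'(0)\|$ for any two solutions $\xi_1,\xi_1'$ of system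 I and all $t\ge0$; or (b) $p=\min(p_1,p_2)$ for some $p_1,p_2>0$ such that, for all $\xi_1\in\mathbb R^{n_1}$ and $t\ge 0$, $\mu(\partial f_{11}/\partial\xi_1)\le-p_1$ if $H_1(\xi_1)>0$, $\mu(\partial f_{12}/\partial\xi_1)\le-p_2$ if $H_1(\xi_1)<0$, and $\mu[(f_{11}-f_{12})\nabla H_1]=0$ if $H_1(\xi_1)=0$. Put $q=\min(q_1,q_2)$. Then the second system, driven by $\xi_1$, is incrementally exponentially stable with rate $\eta=\min(q,p)$ if $p\ne q$, and with every rate $\eta\in(0,\min(q,p))$ in all cases. Here rate $\eta$ means that there is a constant $K>0$ such that for any two solutions $(\xi_1,\xi_2)$, $(\xi_1',\xi_2')$ of the cascade and all $t\ge0$ $$\|\xi_2(t)-\xi_2'(t)\|\le e^{-\eta t}\big(\|\xi_2(0)-\xi_2'(0)\|+K\|\xi_1(0)-\xi_1'(0)\|\big).$$ -/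

import Mathlib

open Filter Topology MeasureTheory

noncomputable section

/-- The matrix measure (logarithmic norm) of a linear map, for the operator norm induced by the
norm of `E`: `μ(A) = limsup_{h → 0⁺} (‖I + h A‖ - 1) / h`. -/
def matrixMeasure {E : Type*} [NormedAddCommGroup E] [NormedSpace ℝ E] (A : E →L[ℝ] E) : ℝ :=
  limsup (fun h : ℝ => (‖ContinuousLinearMap.id ℝ E + h • A‖ - 1) / h) (𝓝[>] 0)

/-- The rank-one linear map `v ↦ (∇H(ξ) · v) a`, i.e. the matrix `a ∇H(ξ)` (column times row). -/
def colTimesGrad {E : Type*} [NormedAddCommGroup E] [NormedSpace ℝ E]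
    (a : E) (H : E → ℝ) (ξ : E) : E →L[ℝ] E :=
  (fderiv ℝ H ξ).smulRight a

/-- `{H = 0}` is a regular (continuously differentiable) switching hypersurface. -/
def IsSwitchingManifold {E : Type*} [NormedAddCommGroup E] [NormedSpace ℝ E] (H : E → ℝ) : Prop :=
  ContDiff ℝ 1 H ∧ ∀ ξ, H ξ = 0 → fderiv ℝ H ξ ≠ 0

/-- The Filippov set-valued vector field of the bimodal piecewise smooth vector field which equals
`g₁ t` on `{H > 0}` and `g₂ t` on `{H < 0}`: on the switching surface `{H = 0}` it is the set of
all convex combinations of the two modes. -/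
def filippovField {E : Type*} [NormedAddCommGroup E] [NormedSpace ℝ E]
    (g₁ g₂ : ℝ → E → E) (H : E → ℝ) (t : ℝ) (ξ : E) : Set E :=
  if 0 < H ξ then {g₁ t ξ} else if H ξ < 0 then {g₂ t ξ} else segment ℝ (g₁ t ξ) (g₂ t ξ)

/-- `x` solves the differential inclusion `x' ∈ F(t, x)` on `[0, ∞)`: it is absolutely continuous on
compact intervals and satisfies the inclusion for almost every time. -/
def IsSolution {E : Type*} [NormedAddCommGroup E] [NormedSpace ℝ E]
    (F : ℝ → E → Set E) (x : ℝ → E) : Prop :=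
  (∀ T : ℝ, 0 < T → AbsolutelyContinuousOnInterval x 0 T) ∧
    ∀ᵐ t ∂(volume : Measure ℝ), 0 < t → ∃ v ∈ F t (x t), HasDerivAt x v t

/-- `(x₁, x₂)` is a Filippov solution on `[0, ∞)` of the cascade of two bimodal switched systems
`ξ₁' = f₁σ(ξ₁, t)`, `ξ₂' = f₂σ(ξ₁, ξ₂, t)`, where system I switches on `{H₁ = 0}` and system II
switches on `{H₂ = 0}`. (The modes are continuous in the state and the two switching conditions
constrain different coordinates, so the Filippov field of the joint system is the product of
the two.) -/
def IsCascadeSolution {E₁ E₂ : Type*} [NormedAddCommGroup E₁] [NormedSpace ℝ E₁]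
    [NormedAddCommGroup E₂] [NormedSpace ℝ E₂]
    (f₁₁ f₁₂ : ℝ → E₁ → E₁) (H₁ : E₁ → ℝ) (f₂₁ f₂₂ : ℝ → E₁ → E₂ → E₂) (H₂ : E₂ → ℝ)
    (x₁ : ℝ → E₁) (x₂ : ℝ → E₂) : Prop :=
  IsSolution (filippovField f₁₁ f₁₂ H₁) x₁ ∧
    IsSolution (filippovField (fun t => f₂₁ t (x₁ t)) (fun t => f₂₂ t (x₁ t)) H₂) x₂

/-- The differential inclusion `x' ∈ F(t, x)` is (globally) incrementally exponentially stable with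
convergence rate `p`. -/
def IncrementallyExpStable {E : Type*} [NormedAddCommGroup E] [NormedSpace ℝ E]
    (F : ℝ → E → Set E) (p : ℝ) : Prop :=
  ∃ k : ℝ, 0 < k ∧ ∀ x y : ℝ → E, IsSolution F x → IsSolution F y →
    ∀ t : ℝ, 0 ≤ t → ‖x t - y t‖ ≤ k * Real.exp (-p * t) * ‖x 0 - y 0‖

/-- In a cascade, the second system is incrementally exponentially stable with convergence rate `η`
when it is driven by the first one: for any two solutions of the cascade,
`‖δξ₂(t)‖ ≤ e^{-ηt} (‖δξ₂(0)‖ + K ‖δξ₁(0)‖)`, with `K` independent of the solutions and of `t`. -/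
def DrivenIncrementallyExpStable {E₁ E₂ : Type*} [NormedAddCommGroup E₁] [NormedSpace ℝ E₁]
    [NormedAddCommGroup E₂] [NormedSpace ℝ E₂]
    (f₁₁ f₁₂ : ℝ → E₁ → E₁) (H₁ : E₁ → ℝ) (f₂₁ f₂₂ : ℝ → E₁ → E₂ → E₂) (H₂ : E₂ → ℝ)
    (η : ℝ) : Prop :=
  ∃ K : ℝ, 0 < K ∧ ∀ (x₁ y₁ : ℝ → E₁) (x₂ y₂ : ℝ → E₂),
    IsCascadeSolution f₁₁ f₁₂ H₁ f₂₁ f₂₂ H₂ x₁ x₂ →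
    IsCascadeSolution f₁₁ f₁₂ H₁ f₂₁ f₂₂ H₂ y₁ y₂ →
    ∀ t : ℝ, 0 ≤ t →
      ‖x₂ t - y₂ t‖ ≤ Real.exp (-η * t) * (‖x₂ 0 - y₂ 0‖ + K * ‖x₁ 0 - y₁ 0‖)

/-- The matrix measure conditions on a bimodal switched system with modes `g₁` (active on
`{H > 0}`) and `g₂` (active on `{H < 0}`): each mode has a Jacobian of matrix measure at most
`-c₁`, respectively `-c₂`, on its region, and `μ[(g₁ - g₂) ∇H] = 0` on the switching surface. -/
structure ContractionConditions {E : Type*} [NormedAddCommGroup E] [NormedSpace ℝ E]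
    (g₁ g₂ : ℝ → E → E) (H : E → ℝ) (c₁ c₂ : ℝ) : Prop where
  mode_one : ∀ t : ℝ, 0 ≤ t → ∀ ξ : E, 0 < H ξ → matrixMeasure (fderiv ℝ (g₁ t) ξ) ≤ -c₁
  mode_two : ∀ t : ℝ, 0 ≤ t → ∀ ξ : E, H ξ < 0 → matrixMeasure (fderiv ℝ (g₂ t) ξ) ≤ -c₂
  switching : ∀ t : ℝ, 0 ≤ t → ∀ ξ : E, H ξ = 0 →
    matrixMeasure (colTimesGrad (g₁ t ξ - g₂ t ξ) H ξ) = 0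

end

/-! ### Norming functionals and the matrix measure -/

section NormingFunctionals

variable {E : Type*} [NormedAddCommGroup E] [NormedSpace ℝ E]

/-! At a fixed time, let `v` and `w` be Filippov velocities at `x` and `y`. The core claim is that
some functional `ℓ` norming `δ = x - y` satisfies `ℓ (v - w) ≤ -q ‖δ‖`
(`ContractionConditions.exists_norming_sub_le`). Walk along the line `y + u δ` and follow the
largest value of `ℓ` on the Filippov sets. Inside a mode it decreases at rate at least `q ‖δ‖`,
because `ℓ (A δ) ≤ μ(A) ‖δ‖`. At the surface, the rank-one condition reads `dH(δ) ℓ(f₁ - f₂) ≤ 0`,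
so every jump goes down. Only a starting point `y` on the surface needs care: if `δ` is transversal,
the walk starts from a one-sided limit; if `δ` is tangent, `ℓ` is chosen to vanish on the jump `f₁ -
f₂`.

Where `‖x - y‖` is differentiable along two solutions, its derivative is `ℓ` of the velocity
difference for every norming `ℓ`, so this freedom of choice is harmless. Replacing the drive `y₁` by
`x₁` costs at most `C ‖x₁ - y₁‖ ≤ C k e^{-pt} ‖δξ₁(0)‖`, and Grönwall gives the rate when `p ≠ q`.
For smaller rates, including the resonant case `p = q`, `p` is first lowered to `η`. -/

theorem norming_apply_le_matrixMeasure (A : E →L[ℝ] E) {ℓ : E →L[ℝ] ℝ} {δ : E}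
    (hℓ : ‖ℓ‖ ≤ 1) (hδ : ℓ δ = ‖δ‖) : ℓ (A δ) ≤ matrixMeasure A * ‖δ‖ := by
  rcases eq_or_ne δ 0 with rfl | h0
  · simp
  have hpos : 0 < ‖δ‖ := norm_pos_iff.2 h0
  rw [← div_le_iff₀ hpos]
  have key : ∀ h : ℝ, 0 < h →
      ℓ (A δ) / ‖δ‖ ≤ (‖ContinuousLinearMap.id ℝ E + h • A‖ - 1) / h := by
    intro h hh
    rw [div_le_div_iff₀ hpos hh]
    have h1 : ℓ ((ContinuousLinearMap.id ℝ E + h • A) δ)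
        ≤ ‖ContinuousLinearMap.id ℝ E + h • A‖ * ‖δ‖ := by
      refine (le_abs_self _).trans ((ℓ.le_opNorm _).trans ?_)
      calc ‖ℓ‖ * ‖(ContinuousLinearMap.id ℝ E + h • A) δ‖
          ≤ 1 * ‖(ContinuousLinearMap.id ℝ E + h • A) δ‖ := by gcongr
        _ ≤ _ := by rw [one_mul]; exact ContinuousLinearMap.le_opNorm _ _
    simp only [add_apply, ContinuousLinearMap.id_apply,
      smul_apply, map_add, map_smul, smul_eq_mul, hδ] at h1
    linarith
  refine le_limsup_of_frequently_le ?_ ?_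
  · refine Eventually.frequently ?_
    filter_upwards [self_mem_nhdsWithin] with h hh using key h hh
  -- A real `limsup` is meaningful only for quotients bounded above; here `‖A‖` bounds them.
  · refine ⟨‖A‖, ?_⟩
    rw [eventually_map]
    filter_upwards [self_mem_nhdsWithin] with h (hh : 0 < h)
    rw [div_le_iff₀ hh]
    have h1 := norm_add_le (ContinuousLinearMap.id ℝ E) (h • A)
    rw [norm_smul, Real.norm_of_nonneg hh.le] at h1
    have h2 := ContinuousLinearMap.norm_id_le (𝕜 := ℝ) (E := E)
    linarith

/-- The rank-one map sends `δ` to `dH(δ) a`. With `a` the jump of the field, the sign says that `ℓ`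
cannot increase when the surface is crossed in direction `δ`. -/
theorem fderiv_mul_norming_nonpos {a : E} {H : E → ℝ} {ξ : E}
    (hμ : matrixMeasure (colTimesGrad a H ξ) = 0) {ℓ : E →L[ℝ] ℝ} {δ : E}
    (hℓ : ‖ℓ‖ ≤ 1) (hδ : ℓ δ = ‖δ‖) : fderiv ℝ H ξ δ * ℓ a ≤ 0 := by
  have h := norming_apply_le_matrixMeasure (colTimesGrad a H ξ) hℓ hδ
  rw [hμ, zero_mul] at h
  simpa [colTimesGrad] using h

/-- Birkhoff orthogonality of the tangent directions to the jump of the vector field. -/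
theorem norm_le_norm_add_smul_of_tangent {a : E} {H : E → ℝ} {ξ : E}
    (hμ : matrixMeasure (colTimesGrad a H ξ) = 0) (hH : fderiv ℝ H ξ ≠ 0) {δ : E}
    (hδ : fderiv ℝ H ξ δ = 0) (τ : ℝ) : ‖δ‖ ≤ ‖δ + τ • a‖ := by
  -- The sign condition is void at a tangent `δ`, so `δ` is perturbed to `δ + κ b` with `b`
  -- transversal. This orientation of `b` forces `τ * ℓ a ≥ 0` for `ℓ` norming `δ + κ b`; then `κ →
  -- 0`.
  obtain ⟨b, hb⟩ : ∃ b, fderiv ℝ H ξ b * τ ≤ 0 ∧ fderiv ℝ H ξ b ≠ 0 := by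
    obtain ⟨b, hb⟩ : ∃ b, fderiv ℝ H ξ b ≠ 0 := by
      by_contra! h
      exact hH (ContinuousLinearMap.ext h)
    rcases le_total (fderiv ℝ H ξ b * τ) 0 with h | h
    · exact ⟨b, h, hb⟩
    · exact ⟨-b, by simpa using h, by simpa using hb⟩
  have key : ∀ κ : ℝ, 0 < κ → ‖δ + κ • b‖ ≤ ‖δ + κ • b + τ • a‖ := by
    intro κ hκ
    obtain ⟨ℓ, hℓ, hℓu⟩ := exists_dual_vector'' ℝ (δ + κ • b)
    have h1 := fderiv_mul_norming_nonpos hμ hℓ hℓu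
    simp only [map_add, map_smul, hδ, smul_eq_mul, zero_add] at h1
    have h3 : 0 ≤ τ * ℓ a := by
      by_contra! h4
      have h5 : fderiv ℝ H ξ b * ℓ a ≤ 0 := by
        by_contra! h6
        have := mul_pos hκ h6
        linarith
      have h6 : 0 < (fderiv ℝ H ξ b) ^ 2 := by have := hb.2; positivity
      have h7 : 0 ≤ (fderiv ℝ H ξ b * τ) * (fderiv ℝ H ξ b * ℓ a) :=
        mul_nonneg_of_nonpos_of_nonpos hb.1 h5
      nlinarith
    have h8 : ℓ (δ + κ • b + τ • a) ≤ ‖δ + κ • b + τ • a‖ := by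
      refine (le_abs_self _).trans ((ℓ.le_opNorm _).trans ?_)
      exact mul_le_of_le_one_left (norm_nonneg _) hℓ
    rw [map_add, hℓu] at h8
    simp only [RCLike.ofReal_real_eq_id, id_eq, map_smul, smul_eq_mul] at h8
    linarith
  have l1 : Tendsto (fun κ : ℝ => ‖δ + κ • b‖) (𝓝[>] 0) (𝓝 ‖δ‖) := by
    have : Continuous (fun κ : ℝ => ‖δ + κ • b‖) := by fun_prop
    simpa using (this.tendsto 0).mono_left nhdsWithin_le_nhds
  have l2 : Tendsto (fun κ : ℝ => ‖δ + κ • b + τ • a‖) (𝓝[>] 0) (𝓝 ‖δ + τ • a‖) := by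
    have : Continuous (fun κ : ℝ => ‖δ + κ • b + τ • a‖) := by fun_prop
    simpa using (this.tendsto 0).mono_left nhdsWithin_le_nhds
  refine le_of_tendsto_of_tendsto l1 l2 ?_
  filter_upwards [self_mem_nhdsWithin] with κ hκ using key κ hκ

/-- The hypothesis says that `δ` keeps its norm in the quotient by the line through `a`. Hahn–Banach
there, pulled back, gives a functional that kills `a`. -/
theorem exists_norming_apply_eq_zero {a δ : E}
    (h : ∀ τ : ℝ, ‖δ‖ ≤ ‖δ + τ • a‖) :
    ∃ ℓ : E →L[ℝ] ℝ, ‖ℓ‖ ≤ 1 ∧ ℓ δ = ‖δ‖ ∧ ℓ a = 0 := by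
  let S : Submodule ℝ E := ℝ ∙ a
  obtain ⟨g, hg, hgδ⟩ := exists_dual_vector'' ℝ (S.mkQ δ)
  have hn : ‖S.mkQ δ‖ = ‖δ‖ := by
    refine le_antisymm (Submodule.Quotient.norm_mk_le S δ) ?_
    refine le_of_forall_pos_lt_add fun ε hε => ?_
    obtain ⟨m, hm, hmε⟩ := Submodule.Quotient.norm_mk_lt (S.mkQ δ) hε
    have hm' : m - δ ∈ S := (Submodule.Quotient.eq S).1 hm
    obtain ⟨τ, hτ⟩ := Submodule.mem_span_singleton.1 hm'
    have := h τ
    rw [hτ, add_sub_cancel] at this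
    linarith
  refine ⟨LinearMap.mkContinuous (g.toLinearMap ∘ₗ S.mkQ) 1 fun z => ?_, ?_, ?_, ?_⟩
  · have h1 : ‖g (S.mkQ z)‖ ≤ ‖S.mkQ z‖ :=
      (g.le_opNorm _).trans (mul_le_of_le_one_left (norm_nonneg _) hg)
    rw [one_mul]
    exact h1.trans (Submodule.Quotient.norm_mk_le S z)
  · exact LinearMap.mkContinuous_norm_le _ zero_le_one _
  · exact hgδ.trans hn
  · have : S.mkQ a = 0 := by simp [S]
    simp [this]

end NormingFunctionals

/-! ### Geometry of the switching surface -/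

section SwitchingSurface

variable {E : Type*} [NormedAddCommGroup E] [NormedSpace ℝ E] {H : E → ℝ}

theorem IsSwitchingManifold.neg (hH : IsSwitchingManifold H) :
    IsSwitchingManifold (fun ξ => -H ξ) := by
  refine ⟨hH.1.neg, fun ξ hξ => ?_⟩
  have : H ξ = 0 := by simpa using hξ
  rw [show (fun ξ => -H ξ) = -H from rfl, fderiv_neg]
  simpa using hH.2 ξ this

theorem IsSwitchingManifold.exists_fderiv_pos (hH : IsSwitchingManifold H) {z : E}
    (hz : H z = 0) : ∃ b, 0 < fderiv ℝ H z b := by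
  obtain ⟨b, hb⟩ : ∃ b, fderiv ℝ H z b ≠ 0 := by
    by_contra! h
    exact hH.2 z hz (ContinuousLinearMap.ext h)
  rcases hb.lt_or_gt with h | h
  · exact ⟨-b, by simpa using h⟩
  · exact ⟨b, h⟩

theorem IsSwitchingManifold.differentiable (hH : IsSwitchingManifold H) : Differentiable ℝ H :=
  hH.1.differentiable (by norm_num)

theorem IsSwitchingManifold.hasDerivAt_line (hH : IsSwitchingManifold H) (z b : E) (s : ℝ) :
    HasDerivAt (fun u : ℝ => H (z + u • b)) (fderiv ℝ H (z + s • b) b) s := by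
  have h1 : HasDerivAt (fun u : ℝ => z + u • b) b s := by
    simpa using ((hasDerivAt_id s).smul_const b).const_add z
  exact (hH.differentiable (z + s • b)).hasFDerivAt.comp_hasDerivAt s h1

theorem IsSwitchingManifold.eventually_pos (hH : IsSwitchingManifold H) {z b : E}
    (hz : H z = 0) (hb : 0 < fderiv ℝ H z b) : ∀ᶠ η : ℝ in 𝓝[>] 0, 0 < H (z + η • b) := by
  have h := (hH.hasDerivAt_line z b 0).tendsto_slope
  simp only [zero_smul, add_zero] at h
  have h2 := (h.mono_left (nhdsWithin_mono (0 : ℝ) (s := Set.Ioi 0) (fun x hx => ne_of_gt hx)))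
    (Ioi_mem_nhds hb)
  filter_upwards [h2, self_mem_nhdsWithin] with η h3 (h4 : 0 < η)
  have h5 : 0 < slope (fun u : ℝ => H (z + u • b)) 0 η := h3
  rw [slope_def_field] at h5
  simp only [zero_smul, add_zero, hz, sub_zero] at h5
  exact (div_pos_iff_of_pos_right h4).1 h5

/-- Lets Jacobian bounds assumed only on an open side pass to the surface by continuity. -/
theorem IsSwitchingManifold.mem_closure_pos (hH : IsSwitchingManifold H) {z : E}
    (hz : 0 ≤ H z) : z ∈ closure {ξ | 0 < H ξ} := by
  rcases hz.lt_or_eq with h | h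
  · exact subset_closure h
  obtain ⟨b, hb⟩ := hH.exists_fderiv_pos h.symm
  have hc : Tendsto (fun η : ℝ => z + η • b) (𝓝[>] 0) (𝓝 z) := by
    have : Continuous (fun η : ℝ => z + η • b) := by fun_prop
    simpa using (this.tendsto 0).mono_left nhdsWithin_le_nhds
  exact mem_closure_of_tendsto hc (hH.eventually_pos h.symm hb)

/-- A line whose direction points weakly towards `{H ≤ 0}` along the surface near one of its points
on the surface cannot reach this point from `{H < 0}`. -/
theorem IsSwitchingManifold.eventually_nonneg_left (hH : IsSwitchingManifold H) {z δ : E}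
    (hz : H z = 0) (hδ : ∀ᶠ ξ in 𝓝 z, H ξ = 0 → fderiv ℝ H ξ δ ≤ 0) :
    ∀ᶠ s : ℝ in 𝓝[<] 0, 0 ≤ H (z + s • δ) := by
  obtain ⟨b, hb⟩ := hH.exists_fderiv_pos hz
  have hcont : Continuous (fun ξ => fderiv ℝ H ξ b) :=
    (hH.1.continuous_fderiv (by norm_num)).clm_apply continuous_const
  have hb' : ∀ᶠ ξ in 𝓝 z, 0 < fderiv ℝ H ξ b := hcont.continuousAt (Ioi_mem_nhds hb)
  obtain ⟨r, hr, hball⟩ := Metric.eventually_nhds_iff_ball.1 (hδ.and hb')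
  have hs : ∀ᶠ s : ℝ in 𝓝[<] 0, ‖s • δ‖ < r / 2 := by
    have h : Continuous (fun s : ℝ => ‖s • δ‖) := by fun_prop
    have h2 := (h.tendsto 0).mono_left (nhdsWithin_le_nhds (s := Set.Iio 0))
    simp only [zero_smul, norm_zero] at h2
    exact h2 (Iio_mem_nhds (by linarith))
  filter_upwards [hs, self_mem_nhdsWithin] with s hs (hs0 : s < 0)
  by_contra! hneg
  have e1 : ∀ᶠ η : ℝ in 𝓝[>] 0, H (z + s • δ + η • b) < 0 := by
    have h : Continuous (fun η : ℝ => H (z + s • δ + η • b)) := by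
      have := hH.1.continuous
      fun_prop
    have h2 := (h.tendsto 0).mono_left (nhdsWithin_le_nhds (s := Set.Ioi 0))
    simp only [zero_smul, add_zero] at h2
    exact h2 (Iio_mem_nhds hneg)
  have e2 : ∀ᶠ η : ℝ in 𝓝[>] 0, 0 < H (z + η • ((1 / 2 : ℝ) • b)) :=
    hH.eventually_pos hz (by simpa using hb)
  have e3 : ∀ᶠ η : ℝ in 𝓝[>] 0, ‖η • b‖ < r / 2 := by
    have h : Continuous (fun η : ℝ => ‖η • b‖) := by fun_prop
    have h2 := (h.tendsto 0).mono_left (nhdsWithin_le_nhds (s := Set.Ioi 0))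
    simp only [zero_smul, norm_zero] at h2
    exact h2 (Iio_mem_nhds (by linarith))
  obtain ⟨η, ⟨⟨he1, he2⟩, he3⟩, hη⟩ := (((e1.and e2).and e3).and self_mem_nhdsWithin).exists
  have hη0 : (0 : ℝ) < η := hη
  set p := z + s • δ + η • b with hp
  -- The segment from `p` to `p + d = z + (η / 2) b` would go from `H < 0` to `H > 0`. The tilt `-(η
  -- / 2) b` makes the derivative of `H` strictly negative at each zero met, while still ending on
  -- the positive side.
  set d := (-s) • δ + (-(η / 2)) • b with hd
  have hle := image_le_of_deriv_right_lt_deriv_boundary (f := fun u : ℝ => H (p + u • d))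
    (f' := fun u => fderiv ℝ H (p + u • d) d) (a := 0) (b := 1) (B := fun _ => 0)
    (B' := fun _ => 0)
    (fun u _ => (hH.hasDerivAt_line p d u).continuousAt.continuousWithinAt)
    (fun u _ => (hH.hasDerivAt_line p d u).hasDerivWithinAt)
    (by simpa using he1.le) (fun u => hasDerivAt_const u (0 : ℝ)) ?_ (Set.right_mem_Icc.2 zero_le_one)
  · have : p + (1 : ℝ) • d = z + η • ((1 / 2 : ℝ) • b) := by
      rw [hp, hd]; module
    simp only [this] at hle
    linarith
  · intro u hu h0
    have hmem : p + u • d ∈ Metric.ball z r := by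
      rw [mem_ball_iff_norm]
      have : p + u • d - z = (1 - u) • (s • δ) + (1 - u / 2) • (η • b) := by
        rw [hp, hd]; module
      rw [this]
      refine (norm_add_le _ _).trans_lt ?_
      rw [norm_smul _ (s • δ), norm_smul _ (η • b), Real.norm_of_nonneg (by linarith [hu.2]),
        Real.norm_of_nonneg (by linarith [hu.2])]
      have g1 : (1 - u) * ‖s • δ‖ ≤ ‖s • δ‖ :=
        mul_le_of_le_one_left (norm_nonneg _) (by linarith [hu.1])
      have g2 : (1 - u / 2) * ‖η • b‖ ≤ ‖η • b‖ :=
        mul_le_of_le_one_left (norm_nonneg _) (by linarith [hu.1])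
      linarith
    obtain ⟨f1, f2⟩ := hball _ hmem
    have f3 := f1 h0
    simp only [hd, map_add, map_smul, smul_eq_mul] at f3 f2 ⊢
    have g1 := mul_nonpos_of_nonneg_of_nonpos (neg_nonneg.2 hs0.le) f3
    have g2 := mul_pos (half_pos hη0) f2
    linarith

end SwitchingSurface

/-! ### Monotonicity from one-sided local estimates -/

section LocalDescent

/-- Continuous induction for an `M` that may jump down: the left estimate keeps the bound at the
supremum of the good points, and the right one pushes past it. No finiteness of the set of jumps is
needed. -/
theorem le_of_eventually_le_add (M : ℝ → ℝ) {a b : ℝ} (hab : a ≤ b)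
    (hr : ∀ ε > 0, ∀ s, ∀ᶠ u in 𝓝[>] s, M u ≤ M s + ε * (u - s))
    (hl : ∀ ε > 0, ∀ s, ∀ᶠ u in 𝓝[<] s, M s ≤ M u + ε * (s - u)) : M b ≤ M a := by
  have key : ∀ ε > 0, M b ≤ M a + ε * (b - a) := by
    intro ε hε
    set A : Set ℝ := {s | s ∈ Set.Icc a b ∧ M s ≤ M a + ε * (s - a)} with hA
    have haA : a ∈ A := ⟨Set.left_mem_Icc.2 hab, by simp⟩
    have hbdd : BddAbove A := ⟨b, fun s hs => hs.1.2⟩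
    set σ := sSup A with hσ
    have hσab : σ ∈ Set.Icc a b := ⟨le_csSup hbdd haA, csSup_le ⟨a, haA⟩ fun s hs => hs.1.2⟩
    have hσA : σ ∈ A := by
      obtain ⟨l, hl1, hl2⟩ := (mem_nhdsLT_iff_exists_Ioo_subset).1 (hl ε hε σ)
      obtain ⟨s, hs, hs1⟩ := exists_lt_of_lt_csSup ⟨a, haA⟩ hl1
      rcases (le_csSup hbdd hs).lt_or_eq with h | h
      · have h1 : M σ ≤ M s + ε * (σ - s) := hl2 ⟨hs1, h⟩
        exact ⟨hσab, by linarith [hs.2]⟩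
      · rwa [hσ, ← h]
    rcases hσab.2.lt_or_eq with h | h
    · exfalso
      have h1 : ∀ᶠ u in 𝓝[>] σ, u ∈ Set.Ioo σ b := Ioo_mem_nhdsGT h
      obtain ⟨u, hu, hu1⟩ := ((hr ε hε σ).and h1).exists
      have : u ∈ A := ⟨⟨hσab.1.trans hu1.1.le, hu1.2.le⟩, by linarith [hσA.2]⟩
      linarith [le_csSup hbdd this, hu1.1]
    · rw [← h]; exact hσA.2
  have l : Tendsto (fun ε : ℝ => M a + ε * (b - a)) (𝓝[>] 0) (𝓝 (M a)) := by
    have : Continuous (fun ε : ℝ => M a + ε * (b - a)) := by fun_prop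
    simpa using (this.tendsto 0).mono_left nhdsWithin_le_nhds
  refine ge_of_tendsto l ?_
  filter_upwards [self_mem_nhdsWithin] with ε hε using key ε hε

theorem HasDerivAt.eventually_abs_le {φ : ℝ → ℝ} {d s : ℝ} (h : HasDerivAt φ d s) {ε : ℝ}
    (hε : 0 < ε) : ∀ᶠ u in 𝓝 s, |φ u - φ s - (u - s) * d| ≤ ε * |u - s| := by
  simpa using (hasDerivAt_iff_isLittleO.1 h).def hε

theorem HasDerivAt.eventually_le_right {φ : ℝ → ℝ} {d s : ℝ} (h : HasDerivAt φ d s) (hd : d ≤ 0)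
    {ε : ℝ} (hε : 0 < ε) : ∀ᶠ u in 𝓝[>] s, φ u ≤ φ s + ε * (u - s) := by
  filter_upwards [nhdsWithin_le_nhds (h.eventually_abs_le hε), self_mem_nhdsWithin]
    with u hu (hs : s < u)
  rw [abs_of_pos (sub_pos.2 hs)] at hu
  nlinarith [(abs_le.1 hu).2]

theorem HasDerivAt.eventually_le_left {φ : ℝ → ℝ} {d s : ℝ} (h : HasDerivAt φ d s) (hd : d ≤ 0)
    {ε : ℝ} (hε : 0 < ε) : ∀ᶠ u in 𝓝[<] s, φ s ≤ φ u + ε * (s - u) := by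
  filter_upwards [nhdsWithin_le_nhds (h.eventually_abs_le hε), self_mem_nhdsWithin]
    with u hu (hs : u < s)
  rw [abs_of_neg (sub_neg.2 hs)] at hu
  nlinarith [(abs_le.1 hu).1]

end LocalDescent

/-! ### Contraction of the Filippov field at a fixed time -/

section Filippov

variable {E : Type*} [NormedAddCommGroup E] [NormedSpace ℝ E]
  {g₁ g₂ : ℝ → E → E} {H : E → ℝ} {c₁ c₂ t : ℝ}

theorem filippovField_swap (g₁ g₂ : ℝ → E → E) (H : E → ℝ) (t : ℝ) (ξ : E) :
    filippovField g₂ g₁ (fun ξ => -H ξ) t ξ = filippovField g₁ g₂ H t ξ := by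
  unfold filippovField
  rcases lt_trichotomy (H ξ) 0 with h | h | h
  · simp [h, h.not_gt]
  · simp [h, segment_symm]
  · simp [h, h.not_gt]

theorem ContractionConditions.swap (h : ContractionConditions g₁ g₂ H c₁ c₂) :
    ContractionConditions g₂ g₁ (fun ξ => -H ξ) c₂ c₁ := by
  refine ⟨fun t ht ξ hξ => h.mode_two t ht ξ (by linarith),
    fun t ht ξ hξ => h.mode_one t ht ξ (by linarith), fun t ht ξ hξ => ?_⟩
  have e : colTimesGrad (g₂ t ξ - g₁ t ξ) (fun ξ => -H ξ) ξ
      = colTimesGrad (g₁ t ξ - g₂ t ξ) H ξ := by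
    ext v
    rw [colTimesGrad, colTimesGrad, show (fun ξ => -H ξ) = -H from rfl, fderiv_neg]
    simp only [ContinuousLinearMap.smulRight_apply, neg_apply, smul_sub, neg_smul]
    abel
  rw [e]
  exact h.switching t ht ξ (by linarith)

theorem ContractionConditions.norming_mode_one_le (hc : ContractionConditions g₁ g₂ H c₁ c₂)
    (hH : IsSwitchingManifold H) (ht : 0 ≤ t) (hg₁ : ContDiff ℝ 1 (g₁ t))
    {ℓ : E →L[ℝ] ℝ} {δ : E} (hℓ : ‖ℓ‖ ≤ 1) (hδ : ℓ δ = ‖δ‖) {z : E} (hz : 0 ≤ H z) :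
    ℓ (fderiv ℝ (g₁ t) z δ) ≤ -c₁ * ‖δ‖ := by
  have hcont : Continuous (fun ξ => ℓ (fderiv ℝ (g₁ t) ξ δ)) :=
    ℓ.continuous.comp ((hg₁.continuous_fderiv (by norm_num)).clm_apply continuous_const)
  have hcl : IsClosed {ξ | ℓ (fderiv ℝ (g₁ t) ξ δ) ≤ -c₁ * ‖δ‖} :=
    isClosed_le hcont continuous_const
  refine closure_minimal (fun ξ hξ => ?_) hcl (hH.mem_closure_pos hz)
  exact (norming_apply_le_matrixMeasure _ hℓ hδ).trans
    (mul_le_mul_of_nonneg_right (hc.mode_one t ht ξ hξ) (norm_nonneg _))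

theorem ContractionConditions.norming_mode_two_le (hc : ContractionConditions g₁ g₂ H c₁ c₂)
    (hH : IsSwitchingManifold H) (ht : 0 ≤ t) (hg₂ : ContDiff ℝ 1 (g₂ t))
    {ℓ : E →L[ℝ] ℝ} {δ : E} (hℓ : ‖ℓ‖ ≤ 1) (hδ : ℓ δ = ‖δ‖) {z : E} (hz : H z ≤ 0) :
    ℓ (fderiv ℝ (g₂ t) z δ) ≤ -c₂ * ‖δ‖ :=
  hc.swap.norming_mode_one_le hH.neg ht hg₂ hℓ hδ (by linarith)

/-- The largest value of the functional `ℓ` on the Filippov set at `ξ`. -/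
noncomputable def filippovSup (g₁ g₂ : ℝ → E → E) (H : E → ℝ) (t : ℝ) (ℓ : E →L[ℝ] ℝ) (ξ : E) :
    ℝ :=
  if 0 < H ξ then ℓ (g₁ t ξ) else if H ξ < 0 then ℓ (g₂ t ξ) else max (ℓ (g₁ t ξ)) (ℓ (g₂ t ξ))

theorem filippovSup_of_pos (ℓ : E →L[ℝ] ℝ) {ξ : E} (h : 0 < H ξ) :
    filippovSup g₁ g₂ H t ℓ ξ = ℓ (g₁ t ξ) := by
  simp [filippovSup, h]

theorem filippovSup_of_neg (ℓ : E →L[ℝ] ℝ) {ξ : E} (h : H ξ < 0) :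
    filippovSup g₁ g₂ H t ℓ ξ = ℓ (g₂ t ξ) := by
  simp [filippovSup, h, h.not_gt]

theorem filippovSup_of_eq (ℓ : E →L[ℝ] ℝ) {ξ : E} (h : H ξ = 0) :
    filippovSup g₁ g₂ H t ℓ ξ = max (ℓ (g₁ t ξ)) (ℓ (g₂ t ξ)) := by
  simp [filippovSup, h]

theorem filippovSup_eq_or (ℓ : E →L[ℝ] ℝ) (ξ : E) :
    filippovSup g₁ g₂ H t ℓ ξ = ℓ (g₁ t ξ) ∨ filippovSup g₁ g₂ H t ℓ ξ = ℓ (g₂ t ξ) := by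
  unfold filippovSup
  split_ifs
  · exact Or.inl rfl
  · exact Or.inr rfl
  · exact max_choice _ _

theorem filippovSup_swap (g₁ g₂ : ℝ → E → E) (H : E → ℝ) (t : ℝ) (ℓ : E →L[ℝ] ℝ) (ξ : E) :
    filippovSup g₂ g₁ (fun ξ => -H ξ) t ℓ ξ = filippovSup g₁ g₂ H t ℓ ξ := by
  unfold filippovSup
  rcases lt_trichotomy (H ξ) 0 with h | h | h
  · simp [h, h.not_gt]
  · simp [h, max_comm]
  · simp [h, h.not_gt]

theorem le_filippovSup_of_mem (ℓ : E →L[ℝ] ℝ) {ξ v : E} (hv : v ∈ filippovField g₁ g₂ H t ξ) :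
    ℓ v ≤ filippovSup g₁ g₂ H t ℓ ξ := by
  unfold filippovField at hv
  unfold filippovSup
  split_ifs at hv ⊢
  · rw [Set.mem_singleton_iff.1 hv]
  · rw [Set.mem_singleton_iff.1 hv]
  · obtain ⟨a, b, ha, hb, hab, rfl⟩ := hv
    simp only [map_add, map_smul, smul_eq_mul]
    have h1 := mul_le_mul_of_nonneg_left (le_max_left (ℓ (g₁ t ξ)) (ℓ (g₂ t ξ))) ha
    have h2 := mul_le_mul_of_nonneg_left (le_max_right (ℓ (g₁ t ξ)) (ℓ (g₂ t ξ))) hb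
    calc _ ≤ (a + b) * max (ℓ (g₁ t ξ)) (ℓ (g₂ t ξ)) := by linarith
      _ = _ := by rw [hab, one_mul]

theorem hasDerivAt_apply_line {g : E → E} (hg : ContDiff ℝ 1 g) (ℓ : E →L[ℝ] ℝ) (z δ : E)
    (c s : ℝ) :
    HasDerivAt (fun u : ℝ => ℓ (g (z + u • δ)) + c * u) (ℓ (fderiv ℝ g (z + s • δ) δ) + c) s := by
  have h1 : HasDerivAt (fun u : ℝ => z + u • δ) δ s := by
    simpa using ((hasDerivAt_id s).smul_const δ).const_add z
  have h2 := ((hg.differentiable (by norm_num)) (z + s • δ)).hasFDerivAt.comp_hasDerivAt s h1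
  have h3 := ℓ.hasFDerivAt.comp_hasDerivAt s h2
  exact h3.add (by simpa using (hasDerivAt_id s).const_mul c)

/-- If `ℓ` increases along the jump from mode two to mode one, the line cannot reach the switching
surface from the region of mode two. -/
theorem ContractionConditions.eventually_nonneg_left (hc : ContractionConditions g₁ g₂ H c₁ c₂)
    (hH : IsSwitchingManifold H) (ht : 0 ≤ t)
    (hg₁ : ContDiff ℝ 1 (g₁ t)) (hg₂ : ContDiff ℝ 1 (g₂ t))
    {ℓ : E →L[ℝ] ℝ} {δ : E} (hℓ : ‖ℓ‖ ≤ 1) (hδ : ℓ δ = ‖δ‖) (z : E) {s : ℝ}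
    (hz : H (z + s • δ) = 0) (hlt : ℓ (g₂ t (z + s • δ)) < ℓ (g₁ t (z + s • δ))) :
    ∀ᶠ u in 𝓝[<] s, 0 ≤ H (z + u • δ) := by
  have hcont : Continuous (fun ξ => ℓ (g₁ t ξ) - ℓ (g₂ t ξ)) := by
    have h1 := hg₁.continuous
    have h2 := hg₂.continuous
    fun_prop
  have hpos : ∀ᶠ ξ in 𝓝 (z + s • δ), 0 < ℓ (g₁ t ξ) - ℓ (g₂ t ξ) :=
    hcont.continuousAt (Ioi_mem_nhds (sub_pos.2 hlt))
  have h := hH.eventually_nonneg_left hz (δ := δ) <| by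
    filter_upwards [hpos] with ξ hξ h0
    have h1 := fderiv_mul_norming_nonpos (hc.switching t ht ξ h0) hℓ hδ
    rw [map_sub] at h1
    exact nonpos_of_mul_nonpos_left h1 hξ
  have hlim : Tendsto (fun u : ℝ => u - s) (𝓝[<] s) (𝓝[<] 0) := by
    refine tendsto_nhdsWithin_iff.2 ⟨?_, ?_⟩
    · have : Continuous (fun u : ℝ => u - s) := by fun_prop
      simpa using (this.tendsto s).mono_left nhdsWithin_le_nhds
    · filter_upwards [self_mem_nhdsWithin] with u (hu : u < s) using sub_neg.2 hu
  filter_upwards [hlim.eventually h] with u hu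
  have e : z + s • δ + (u - s) • δ = z + u • δ := by module
  rwa [e] at hu

/-- One-sided descent estimates of the largest value of a norming functional on the Filippov sets
along a line, at a point where this value is the one of mode one. -/
theorem ContractionConditions.filippovSup_local (hc : ContractionConditions g₁ g₂ H c₁ c₂)
    (hH : IsSwitchingManifold H) (ht : 0 ≤ t)
    (hg₁ : ContDiff ℝ 1 (g₁ t)) (hg₂ : ContDiff ℝ 1 (g₂ t))
    {ℓ : E →L[ℝ] ℝ} {δ : E} (hℓ : ‖ℓ‖ ≤ 1) (hδ : ℓ δ = ‖δ‖) (z : E) {q : ℝ}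
    (hq₁ : q ≤ c₁) (hq₂ : q ≤ c₂) {ε : ℝ} (hε : 0 < ε) {s : ℝ}
    (hs : 0 < H (z + s • δ) ∨ H (z + s • δ) = 0 ∧ ℓ (g₂ t (z + s • δ)) ≤ ℓ (g₁ t (z + s • δ))) :
    (∀ᶠ u in 𝓝[>] s, filippovSup g₁ g₂ H t ℓ (z + u • δ) + q * ‖δ‖ * u ≤
      filippovSup g₁ g₂ H t ℓ (z + s • δ) + q * ‖δ‖ * s + ε * (u - s)) ∧
    (∀ᶠ u in 𝓝[<] s, filippovSup g₁ g₂ H t ℓ (z + s • δ) + q * ‖δ‖ * s ≤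
      filippovSup g₁ g₂ H t ℓ (z + u • δ) + q * ‖δ‖ * u + ε * (s - u)) := by
  have hn := norm_nonneg δ
  have d1 := hasDerivAt_apply_line hg₁ ℓ z δ (q * ‖δ‖) s
  have d2 := hasDerivAt_apply_line hg₂ ℓ z δ (q * ‖δ‖) s
  have hz0 : 0 ≤ H (z + s • δ) := hs.elim le_of_lt fun h => h.1.ge
  have n1 : ℓ (fderiv ℝ (g₁ t) (z + s • δ) δ) + q * ‖δ‖ ≤ 0 := by
    have := hc.norming_mode_one_le hH ht hg₁ hℓ hδ hz0
    nlinarith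
  have r1 := d1.eventually_le_right n1 hε
  have l1 := d1.eventually_le_left n1 hε
  have cH : Continuous (fun u : ℝ => H (z + u • δ)) := by
    have := hH.1.continuous
    fun_prop
  rcases hs with hpos | ⟨hzero, hle⟩
  · have hev : ∀ᶠ u in 𝓝 s, 0 < H (z + u • δ) := cH.continuousAt (Ioi_mem_nhds hpos)
    rw [filippovSup_of_pos ℓ hpos]
    refine ⟨?_, ?_⟩
    · filter_upwards [r1, nhdsWithin_le_nhds hev] with u h1 h2
      rwa [filippovSup_of_pos ℓ h2]
    · filter_upwards [l1, nhdsWithin_le_nhds hev] with u h1 h2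
      rwa [filippovSup_of_pos ℓ h2]
  have n2 : ℓ (fderiv ℝ (g₂ t) (z + s • δ) δ) + q * ‖δ‖ ≤ 0 := by
    have := hc.norming_mode_two_le hH ht hg₂ hℓ hδ hzero.le
    nlinarith
  have r2 := d2.eventually_le_right n2 hε
  have l2 := d2.eventually_le_left n2 hε
  rw [filippovSup_of_eq ℓ hzero, max_eq_left hle]
  refine ⟨?_, ?_⟩
  · filter_upwards [r1, r2] with u h1 h2
    rcases filippovSup_eq_or (g₁ := g₁) (g₂ := g₂) (H := H) (t := t) ℓ (z + u • δ) with h | h <;>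
      rw [h] <;> linarith
  -- From the left, a strict maximum excludes the side of mode two, so the mode-one bound suffices.
  -- In a tie, either branch starts from the same value at `s`.
  · rcases hle.lt_or_eq with hlt | heq
    · filter_upwards [l1, hc.eventually_nonneg_left hH ht hg₁ hg₂ hℓ hδ z hzero hlt] with u h1 h2
      have h3 : ℓ (g₁ t (z + u • δ)) ≤ filippovSup g₁ g₂ H t ℓ (z + u • δ) := by
        rcases h2.lt_or_eq with h | h
        · rw [filippovSup_of_pos ℓ h]
        · rw [filippovSup_of_eq ℓ h.symm]; exact le_max_left _ _
      linarith
    · filter_upwards [l1, l2] with u h1 h2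
      rcases filippovSup_eq_or (g₁ := g₁) (g₂ := g₂) (H := H) (t := t) ℓ (z + u • δ) with h | h <;>
        rw [h] <;> linarith

/-- Smooth decrease and downward jumps are combined by `le_of_eventually_le_add`, so the line may
meet the surface infinitely often or run inside it. -/
theorem ContractionConditions.filippovSup_antitone (hc : ContractionConditions g₁ g₂ H c₁ c₂)
    (hH : IsSwitchingManifold H) (ht : 0 ≤ t)
    (hg₁ : ContDiff ℝ 1 (g₁ t)) (hg₂ : ContDiff ℝ 1 (g₂ t))
    {ℓ : E →L[ℝ] ℝ} {δ : E} (hℓ : ‖ℓ‖ ≤ 1) (hδ : ℓ δ = ‖δ‖) (z : E) :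
    Antitone (fun u : ℝ => filippovSup g₁ g₂ H t ℓ (z + u • δ) + min c₁ c₂ * ‖δ‖ * u) := by
  have key : ∀ ε > 0, ∀ s : ℝ,
      (∀ᶠ u in 𝓝[>] s, filippovSup g₁ g₂ H t ℓ (z + u • δ) + min c₁ c₂ * ‖δ‖ * u ≤
        filippovSup g₁ g₂ H t ℓ (z + s • δ) + min c₁ c₂ * ‖δ‖ * s + ε * (u - s)) ∧
      (∀ᶠ u in 𝓝[<] s, filippovSup g₁ g₂ H t ℓ (z + s • δ) + min c₁ c₂ * ‖δ‖ * s ≤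
        filippovSup g₁ g₂ H t ℓ (z + u • δ) + min c₁ c₂ * ‖δ‖ * u + ε * (s - u)) := by
    intro ε hε s
    by_cases h : 0 < H (z + s • δ) ∨
        H (z + s • δ) = 0 ∧ ℓ (g₂ t (z + s • δ)) ≤ ℓ (g₁ t (z + s • δ))
    · exact hc.filippovSup_local hH ht hg₁ hg₂ hℓ hδ z (min_le_left _ _) (min_le_right _ _) hε h
    · have h' : 0 < -H (z + s • δ) ∨
          -H (z + s • δ) = 0 ∧ ℓ (g₁ t (z + s • δ)) ≤ ℓ (g₂ t (z + s • δ)) := by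
        push Not at h
        rcases h.1.lt_or_eq with h1 | h1
        · exact Or.inl (by linarith)
        · exact Or.inr ⟨by linarith, (h.2 h1).le⟩
      have := hc.swap.filippovSup_local hH.neg ht hg₂ hg₁ hℓ hδ z (min_le_right c₁ c₂)
        (min_le_left c₁ c₂) hε h'
      simpa only [filippovSup_swap] using this
  intro a b hab
  exact le_of_eventually_le_add _ hab (fun ε hε s => (key ε hε s).1) fun ε hε s => (key ε hε s).2

/-- Here `ℓ w` may lie below the maximum over the Filippov set at `y`. As the line enters `{H > 0}`
at once, the descent can start from the limit `ℓ (g₁ t y)`, which is at most `ℓ w`. -/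
theorem ContractionConditions.norming_sub_le_of_transversal
    (hc : ContractionConditions g₁ g₂ H c₁ c₂)
    (hH : IsSwitchingManifold H) (ht : 0 ≤ t)
    (hg₁ : ContDiff ℝ 1 (g₁ t)) (hg₂ : ContDiff ℝ 1 (g₂ t))
    {ℓ : E →L[ℝ] ℝ} {y δ v w : E} (hℓ : ‖ℓ‖ ≤ 1) (hδ : ℓ δ = ‖δ‖)
    (hy : H y = 0) (hpos : 0 < fderiv ℝ H y δ)
    (hv : v ∈ filippovField g₁ g₂ H t (y + δ)) (hw : w ∈ filippovField g₁ g₂ H t y) :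
    ℓ (v - w) ≤ -min c₁ c₂ * ‖δ‖ := by
  have hanti := hc.filippovSup_antitone hH ht hg₁ hg₂ hℓ hδ y
  have hjump : ℓ (g₁ t y) ≤ ℓ (g₂ t y) := by
    have h := fderiv_mul_norming_nonpos (hc.switching t ht y hy) hℓ hδ
    rw [map_sub] at h
    have := nonpos_of_mul_nonpos_right h hpos
    linarith
  have hw1 : ℓ (g₁ t y) ≤ ℓ w := by
    rw [filippovField, if_neg (by simp [hy]), if_neg (by simp [hy])] at hw
    obtain ⟨a, b, ha, hb, hab, rfl⟩ := hw
    simp only [map_add, map_smul, smul_eq_mul]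
    have h2 := mul_le_mul_of_nonneg_left hjump hb
    calc ℓ (g₁ t y) = (a + b) * ℓ (g₁ t y) := by rw [hab, one_mul]
      _ ≤ _ := by linarith
  have hlim : Tendsto (fun u : ℝ => ℓ (g₁ t (y + u • δ)) + min c₁ c₂ * ‖δ‖ * u) (𝓝[>] 0)
      (𝓝 (ℓ (g₁ t y))) := by
    have : Continuous (fun u : ℝ => ℓ (g₁ t (y + u • δ)) + min c₁ c₂ * ‖δ‖ * u) := by
      have := hg₁.continuous
      fun_prop
    simpa using (this.tendsto 0).mono_left nhdsWithin_le_nhds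
  have hM : filippovSup g₁ g₂ H t ℓ (y + (1 : ℝ) • δ) + min c₁ c₂ * ‖δ‖ * 1 ≤ ℓ (g₁ t y) := by
    refine ge_of_tendsto hlim ?_
    filter_upwards [hH.eventually_pos hy hpos, Ioo_mem_nhdsGT (zero_lt_one' ℝ)] with u h1 h2
    rw [← filippovSup_of_pos (g₁ := g₁) (g₂ := g₂) ℓ h1]
    exact hanti h2.2.le
  have hv1 := le_filippovSup_of_mem ℓ hv
  rw [one_smul] at hM
  rw [map_sub]
  linarith

/-- Infinitesimal contraction of a bimodal Filippov field: the difference of any two of its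
velocities is dissipative for some functional norming the difference of the positions. -/
theorem ContractionConditions.exists_norming_sub_le (hc : ContractionConditions g₁ g₂ H c₁ c₂)
    (hH : IsSwitchingManifold H) (ht : 0 ≤ t)
    (hg₁ : ContDiff ℝ 1 (g₁ t)) (hg₂ : ContDiff ℝ 1 (g₂ t)) {x y v w : E}
    (hv : v ∈ filippovField g₁ g₂ H t x) (hw : w ∈ filippovField g₁ g₂ H t y) :
    ∃ ℓ : E →L[ℝ] ℝ, ‖ℓ‖ ≤ 1 ∧ ℓ (x - y) = ‖x - y‖ ∧ ℓ (v - w) ≤ -min c₁ c₂ * ‖x - y‖ := by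
  obtain ⟨δ, rfl⟩ : ∃ δ, x = y + δ := ⟨x - y, by abel⟩
  rw [add_sub_cancel_left]
  have base : ∀ ℓ : E →L[ℝ] ℝ, ‖ℓ‖ ≤ 1 → ℓ δ = ‖δ‖ →
      filippovSup g₁ g₂ H t ℓ y ≤ ℓ w → ℓ (v - w) ≤ -min c₁ c₂ * ‖δ‖ := by
    intro ℓ hℓ hδ hM
    have h1 := hc.filippovSup_antitone hH ht hg₁ hg₂ hℓ hδ y zero_le_one
    have h2 := le_filippovSup_of_mem ℓ hv
    simp only [one_smul, zero_smul, add_zero, mul_one, mul_zero] at h1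
    rw [map_sub]
    linarith
  obtain ⟨ℓ, hℓ, hδ⟩ := exists_dual_vector'' ℝ δ
  rcases lt_trichotomy (H y) 0 with hy | hy | hy
  · refine ⟨ℓ, hℓ, hδ, base ℓ hℓ hδ ?_⟩
    rw [filippovField, if_neg hy.not_gt, if_pos hy, Set.mem_singleton_iff] at hw
    rw [filippovSup_of_neg ℓ hy, hw]
  · rcases lt_trichotomy (fderiv ℝ H y δ) 0 with hd | hd | hd
    · refine ⟨ℓ, hℓ, hδ, ?_⟩
      rw [min_comm]
      refine hc.swap.norming_sub_le_of_transversal hH.neg ht hg₂ hg₁ hℓ hδ (y := y) (by linarith) ?_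
        (by rwa [filippovField_swap]) (by rwa [filippovField_swap])
      rw [show (fun ξ => -H ξ) = -H from rfl, fderiv_neg]
      simpa using hd
    -- With `ℓ` vanishing on the jump, all convex combinations at `y` have the same value, so `w`
    -- attains the maximum.
    · obtain ⟨ℓ, hℓ, hδ, ha⟩ := exists_norming_apply_eq_zero
        (norm_le_norm_add_smul_of_tangent (hc.switching t ht y hy) (hH.2 y hy) hd)
      refine ⟨ℓ, hℓ, hδ, base ℓ hℓ hδ ?_⟩
      rw [map_sub, sub_eq_zero] at ha
      rw [filippovField, if_neg (by simp [hy]), if_neg (by simp [hy])] at hw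
      obtain ⟨a, b, -, -, hab, rfl⟩ := hw
      rw [filippovSup_of_eq ℓ hy, ha, max_self]
      simp only [map_add, map_smul, smul_eq_mul, ha]
      rw [← add_mul, hab, one_mul]
    · exact ⟨ℓ, hℓ, hδ, hc.norming_sub_le_of_transversal hH ht hg₁ hg₂ hℓ hδ hy hd hv hw⟩
  · refine ⟨ℓ, hℓ, hδ, base ℓ hℓ hδ ?_⟩
    rw [filippovField, if_pos hy, Set.mem_singleton_iff] at hw
    rw [filippovSup_of_pos ℓ hy, hw]

end Filippov

/-! ### Grönwall estimate along absolutely continuous curves -/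

section AbsolutelyContinuous

theorem AbsolutelyContinuousOnInterval.norm {E : Type*} [NormedAddCommGroup E] {f : ℝ → E}
    {a b : ℝ} (hf : AbsolutelyContinuousOnInterval f a b) :
    AbsolutelyContinuousOnInterval (fun t => ‖f t‖) a b := by
  refine squeeze_zero (fun t => ?_) (fun t => ?_) hf
  · exact Finset.sum_nonneg fun i _ => dist_nonneg
  · exact Finset.sum_le_sum fun i _ =>
      (dist_norm_norm_le _ _).trans_eq (dist_eq_norm _ _).symm

theorem AbsolutelyContinuousOnInterval.le_of_ae_deriv_nonpos {G : ℝ → ℝ} {a b : ℝ} (hab : a ≤ b)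
    (hG : AbsolutelyContinuousOnInterval G a b)
    (h : ∀ᵐ t ∂(volume : Measure ℝ), t ∈ Set.Ioc a b → deriv G t ≤ 0) : G b ≤ G a := by
  have h1 := hG.integral_deriv_eq_sub
  have h2 : ∫ t in a..b, deriv G t ≤ 0 := by
    rw [intervalIntegral.integral_of_le hab]
    refine integral_nonpos_of_ae ?_
    exact (ae_restrict_iff' measurableSet_Ioc).2 h
  linarith

/-- `‖z s‖ - ℓ (z s)` is nonnegative and vanishes at `t`, a minimum. The derivative is thus the same
for every norming `ℓ`. -/
theorem HasDerivAt.norm_deriv_eq_of_norming {E : Type*} [NormedAddCommGroup E] [NormedSpace ℝ E]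
    {z : ℝ → E} {u : E} {t d : ℝ} (hz : HasDerivAt z u t) (hn : HasDerivAt (fun s => ‖z s‖) d t)
    {ℓ : E →L[ℝ] ℝ} (hℓ : ‖ℓ‖ ≤ 1) (hδ : ℓ (z t) = ‖z t‖) : d = ℓ u := by
  have hd : HasDerivAt (fun s => ‖z s‖ - ℓ (z s)) (d - ℓ u) t :=
    hn.sub (ℓ.hasFDerivAt.comp_hasDerivAt t hz)
  have hmin : IsLocalMin (fun s => ‖z s‖ - ℓ (z s)) t := by
    refine Eventually.of_forall fun s => ?_
    simp only [hδ, sub_self, sub_nonneg]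
    exact (le_abs_self _).trans ((ℓ.le_opNorm _).trans (mul_le_of_le_one_left (norm_nonneg _) hℓ))
  linarith [hmin.hasDerivAt_eq_zero hd]

/-- A Grönwall estimate for the distance of two absolutely continuous curves. -/
theorem exp_mul_norm_sub_le {E : Type*} [NormedAddCommGroup E] [NormedSpace ℝ E] {x y : ℝ → E}
    (hx : ∀ T : ℝ, 0 < T → AbsolutelyContinuousOnInterval x 0 T)
    (hy : ∀ T : ℝ, 0 < T → AbsolutelyContinuousOnInterval y 0 T) {q p B : ℝ}
    (h : ∀ᵐ t ∂(volume : Measure ℝ), 0 < t → ∃ v w, HasDerivAt x v t ∧ HasDerivAt y w t ∧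
      ∃ ℓ : E →L[ℝ] ℝ, ‖ℓ‖ ≤ 1 ∧ ℓ (x t - y t) = ‖x t - y t‖ ∧
        ℓ (v - w) ≤ -q * ‖x t - y t‖ + B * (q - p) * Real.exp (-p * t)) {T : ℝ} (hT : 0 ≤ T) :
    Real.exp (q * T) * ‖x T - y T‖ - B * Real.exp ((q - p) * T) ≤ ‖x 0 - y 0‖ - B := by
  rcases hT.eq_or_lt with rfl | hT
  · simp
  have hr : AbsolutelyContinuousOnInterval (fun t => ‖x t - y t‖) 0 T :=
    ((hx T hT).sub (hy T hT)).norm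
  have hexp : ∀ c : ℝ, AbsolutelyContinuousOnInterval (fun t => Real.exp (c * t)) 0 T := fun c =>
    ContDiffOn.absolutelyContinuousOnInterval (by fun_prop)
  have hG : AbsolutelyContinuousOnInterval
      (fun t => Real.exp (q * t) * ‖x t - y t‖ - B * Real.exp ((q - p) * t)) 0 T :=
    ((hexp q).mul hr).sub ((hexp (q - p)).const_mul B)
  have hmain := hG.le_of_ae_deriv_nonpos hT.le <| by
    filter_upwards [h, hr.ae_differentiableAt] with t ht hd htT
    obtain ⟨v, w, hv, hw, ℓ, hℓ, hδ, hle⟩ := ht htT.1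
    have hn := (hd (by rw [Set.uIcc_of_le hT.le]; exact Set.Ioc_subset_Icc_self htT)).hasDerivAt
    have hdn := (hv.sub hw).norm_deriv_eq_of_norming hn hℓ hδ
    have he : ∀ c : ℝ, HasDerivAt (fun t => Real.exp (c * t)) (Real.exp (c * t) * c) t := fun c =>
      HasDerivAt.exp (by simpa using (hasDerivAt_id t).const_mul c)
    -- Times `exp (q * t)`, the forcing `B (q - p) exp (-p * t)` is exactly the derivative of the
    -- subtracted term.
    have hGd := ((he q).mul hn).sub ((he (q - p)).const_mul B)
    refine hGd.deriv.trans_le ?_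
    rw [hdn]
    have e1 : Real.exp ((q - p) * t) = Real.exp (q * t) * Real.exp (-p * t) := by
      rw [← Real.exp_add]; ring_nf
    rw [e1]
    have := mul_le_mul_of_nonneg_left hle (Real.exp_pos (q * t)).le
    linarith
  simpa using hmain

end AbsolutelyContinuous

/-! ### Contracting systems and their cascade -/

section Systems

variable {E : Type*} [NormedAddCommGroup E] [NormedSpace ℝ E]

theorem ContractionConditions.incrementallyExpStable {g₁ g₂ : ℝ → E → E} {H : E → ℝ} {c₁ c₂ : ℝ}
    (hc : ContractionConditions g₁ g₂ H c₁ c₂) (hH : IsSwitchingManifold H)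
    (hg₁ : ∀ t : ℝ, 0 ≤ t → ContDiff ℝ 1 (g₁ t)) (hg₂ : ∀ t : ℝ, 0 ≤ t → ContDiff ℝ 1 (g₂ t)) :
    IncrementallyExpStable (filippovField g₁ g₂ H) (min c₁ c₂) := by
  refine ⟨1, one_pos, fun x y hx hy t ht => ?_⟩
  have h := exp_mul_norm_sub_le hx.1 hy.1 (q := min c₁ c₂) (p := 0) (B := 0) (by
    filter_upwards [hx.2, hy.2] with s hxs hys hs
    obtain ⟨v, hv, hxv⟩ := hxs hs
    obtain ⟨w, hw, hyw⟩ := hys hs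
    obtain ⟨ℓ, hℓ, hδ, hle⟩ := hc.exists_norming_sub_le hH hs.le (hg₁ s hs.le) (hg₂ s hs.le) hv hw
    exact ⟨v, w, hxv, hyw, ℓ, hℓ, hδ, by simpa using hle⟩) ht
  simp only [zero_mul, sub_zero] at h
  have e := mul_le_mul_of_nonneg_left h (Real.exp_pos (-min c₁ c₂ * t)).le
  rw [← mul_assoc, ← Real.exp_add, neg_mul, neg_add_cancel, Real.exp_zero, one_mul] at e
  rwa [one_mul, neg_mul]

theorem IncrementallyExpStable.mono {F : ℝ → E → Set E} {p η : ℝ}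
    (h : IncrementallyExpStable F p) (hη : η ≤ p) : IncrementallyExpStable F η := by
  obtain ⟨k, hk, h⟩ := h
  refine ⟨k, hk, fun x y hx hy t ht => (h x y hx hy t ht).trans ?_⟩
  gcongr

/-- The Filippov set depends on the modes in a Lipschitz way. -/
theorem exists_mem_filippovField_norm_sub_le {g₁ g₂ g₁' g₂' : ℝ → E → E} {H : E → ℝ} {t c : ℝ}
    {ξ w : E} (h₁ : 0 ≤ H ξ → ‖g₁' t ξ - g₁ t ξ‖ ≤ c) (h₂ : H ξ ≤ 0 → ‖g₂' t ξ - g₂ t ξ‖ ≤ c)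
    (hw : w ∈ filippovField g₁ g₂ H t ξ) :
    ∃ w' ∈ filippovField g₁' g₂' H t ξ, ‖w' - w‖ ≤ c := by
  unfold filippovField at hw ⊢
  split_ifs at hw ⊢ with hp hn
  · exact ⟨_, rfl, by rw [Set.mem_singleton_iff.1 hw]; exact h₁ hp.le⟩
  · exact ⟨_, rfl, by rw [Set.mem_singleton_iff.1 hw]; exact h₂ hn.le⟩
  · obtain ⟨r, s, hr, hs, hrs, rfl⟩ := hw
    refine ⟨_, ⟨r, s, hr, hs, hrs, rfl⟩, ?_⟩
    have e : r • g₁' t ξ + s • g₂' t ξ - (r • g₁ t ξ + s • g₂ t ξ)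
        = r • (g₁' t ξ - g₁ t ξ) + s • (g₂' t ξ - g₂ t ξ) := by module
    rw [e]
    refine (norm_add_le _ _).trans ?_
    rw [norm_smul, norm_smul, Real.norm_of_nonneg hr, Real.norm_of_nonneg hs]
    calc _ ≤ r * c + s * c := by
          gcongr
          · exact h₁ (not_lt.1 hn)
          · exact h₂ (not_lt.1 hp)
      _ = c := by rw [← add_mul, hrs, one_mul]

variable {E₁ E₂ : Type*} [NormedAddCommGroup E₁] [NormedSpace ℝ E₁]
  [NormedAddCommGroup E₂] [NormedSpace ℝ E₂]

/-- Since `H` does not involve the driving variable, the mean value inequality applies on all of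
`E₁` with `ξ₂` fixed. -/
theorem norm_sub_le_of_fderiv_le_on_pos {f : E₁ → E₂ → E₂} {H : E₂ → ℝ}
    (hH : IsSwitchingManifold H) (hf : ContDiff ℝ 1 (fun ξ : E₁ × E₂ => f ξ.1 ξ.2)) {c : ℝ}
    (hJ : ∀ ξ₁ ξ₂, 0 < H ξ₂ → ‖fderiv ℝ (fun ξ => f ξ ξ₂) ξ₁‖ ≤ c) (a b : E₁) {ξ₂ : E₂}
    (hξ : 0 ≤ H ξ₂) : ‖f a ξ₂ - f b ξ₂‖ ≤ c * ‖a - b‖ := by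
  have hcont : ∀ a, Continuous (f a) := fun a =>
    hf.continuous.comp (Continuous.prodMk_right a)
  have hcl : IsClosed {ξ | ‖f a ξ - f b ξ‖ ≤ c * ‖a - b‖} :=
    isClosed_le ((hcont a).sub (hcont b)).norm continuous_const
  refine closure_minimal (fun ξ hξ => ?_) hcl (hH.mem_closure_pos hξ)
  have hd : Differentiable ℝ (fun ζ => f ζ ξ) :=
    (hf.comp (contDiff_id.prodMk contDiff_const)).differentiable (by norm_num)
  exact convex_univ.norm_image_sub_le_of_norm_fderiv_le (fun ζ _ => hd ζ)
    (fun ζ _ => hJ ζ ξ hξ) (Set.mem_univ b) (Set.mem_univ a)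

theorem drivenIncrementallyExpStable_of_ne
    {f₁₁ f₁₂ : ℝ → E₁ → E₁} {H₁ : E₁ → ℝ} {f₂₁ f₂₂ : ℝ → E₁ → E₂ → E₂} {H₂ : E₂ → ℝ}
    (hH₂ : IsSwitchingManifold H₂)
    (hf₂₁ : ∀ t : ℝ, 0 ≤ t → ContDiff ℝ 1 (fun ξ : E₁ × E₂ => f₂₁ t ξ.1 ξ.2))
    (hf₂₂ : ∀ t : ℝ, 0 ≤ t → ContDiff ℝ 1 (fun ξ : E₁ × E₂ => f₂₂ t ξ.1 ξ.2))
    {q₁ q₂ c₁ c₂ : ℝ} (hc₁ : 0 < c₁)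
    (hII : ∀ ξ₁ : E₁,
      ContractionConditions (fun t => f₂₁ t ξ₁) (fun t => f₂₂ t ξ₁) H₂ q₁ q₂)
    (hJ₁ : ∀ t : ℝ, 0 ≤ t → ∀ (ξ₁ : E₁) (ξ₂ : E₂), 0 < H₂ ξ₂ →
      ‖fderiv ℝ (fun ξ : E₁ => f₂₁ t ξ ξ₂) ξ₁‖ ≤ c₁)
    (hJ₂ : ∀ t : ℝ, 0 ≤ t → ∀ (ξ₁ : E₁) (ξ₂ : E₂), H₂ ξ₂ < 0 →
      ‖fderiv ℝ (fun ξ : E₁ => f₂₂ t ξ ξ₂) ξ₁‖ ≤ c₂)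
    {p : ℝ} (hI : IncrementallyExpStable (filippovField f₁₁ f₁₂ H₁) p) (hp : p ≠ min q₁ q₂) :
    DrivenIncrementallyExpStable f₁₁ f₁₂ H₁ f₂₁ f₂₂ H₂ (min (min q₁ q₂) p) := by
  obtain ⟨k, hk, hI⟩ := hI
  set q := min q₁ q₂ with hq
  set C := max c₁ c₂ with hC
  have hCpos : 0 < C := hc₁.trans_le (le_max_left _ _)
  have hqp : q - p ≠ 0 := sub_ne_zero.2 hp.symm
  refine ⟨C * k / |q - p|, by positivity, fun x₁ y₁ x₂ y₂ hx hy t ht => ?_⟩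
  set D := ‖x₁ 0 - y₁ 0‖ with hD
  have hDn : 0 ≤ D := norm_nonneg _
  -- `B` is chosen so that `B (q - p) = C k D`, the size of the driving term; its sign is that of `q
  -- - p`.
  have h := exp_mul_norm_sub_le hx.2.1 hy.2.1 (q := q) (p := p) (B := C * k * D / (q - p)) (by
    filter_upwards [hx.2.2, hy.2.2] with s hxs hys hs
    obtain ⟨v, hv, hxv⟩ := hxs hs
    obtain ⟨w, hw, hyw⟩ := hys hs
    have hdrive := hI x₁ y₁ hx.1 hy.1 s hs.le
    -- `w` belongs to the field driven by `y₁`; `w'` is a nearby velocity of the field driven by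
    -- `x₁`, so that contraction compares two velocities of one field.
    obtain ⟨w', hw', hww⟩ := exists_mem_filippovField_norm_sub_le (c := C * ‖x₁ s - y₁ s‖)
      (g₁' := fun t => f₂₁ t (x₁ s)) (g₂' := fun t => f₂₂ t (x₁ s))
      (fun h => (norm_sub_le_of_fderiv_le_on_pos hH₂ (hf₂₁ s hs.le) (hJ₁ s hs.le) _ _ h).trans
        (mul_le_mul_of_nonneg_right (le_max_left _ _) (norm_nonneg _)))
      (fun h => (norm_sub_le_of_fderiv_le_on_pos hH₂.neg (hf₂₂ s hs.le)
        (fun ξ₁ ξ₂ h' => hJ₂ s hs.le ξ₁ ξ₂ (by linarith)) _ _ (by linarith)).trans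
        (mul_le_mul_of_nonneg_right (le_max_right _ _) (norm_nonneg _))) hw
    have hsec : ∀ ξ₁ : E₁, ContDiff ℝ 1 (fun ξ : E₂ => ((ξ₁, ξ) : E₁ × E₂)) := fun ξ₁ =>
      contDiff_const.prodMk contDiff_id
    obtain ⟨ℓ, hℓ, hδ, hle⟩ := (hII (x₁ s)).exists_norming_sub_le hH₂ hs.le
      ((hf₂₁ s hs.le).comp (hsec (x₁ s))) ((hf₂₂ s hs.le).comp (hsec (x₁ s))) (x := x₂ s)
      (y := y₂ s) (v := v) hv hw'
    refine ⟨v, w, hxv, hyw, ℓ, hℓ, hδ, ?_⟩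
    have e : v - w = (v - w') + (w' - w) := by abel
    have h1 : ℓ (w' - w) ≤ ‖w' - w‖ := (le_abs_self _).trans
      ((ℓ.le_opNorm _).trans (mul_le_of_le_one_left (norm_nonneg _) hℓ))
    have h2 := mul_le_mul_of_nonneg_left hdrive hCpos.le
    rw [e, map_add, div_mul_cancel₀ _ hqp]
    linarith) ht
  set r := ‖x₂ t - y₂ t‖
  set r₀ := ‖x₂ 0 - y₂ 0‖ with hr₀
  have hr₀n : 0 ≤ r₀ := norm_nonneg _
  have hcancel : ∀ a : ℝ, Real.exp (-q * t) * (Real.exp (q * t) * a) = a := fun a => by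
    rw [← mul_assoc, ← Real.exp_add, neg_mul, neg_add_cancel, Real.exp_zero, one_mul]
  rcases hp.lt_or_gt with hlt | hlt
  · have hpos : 0 < q - p := sub_pos.2 hlt
    rw [min_eq_right hlt.le, abs_of_pos hpos]
    have hB : 0 ≤ C * k * D / (q - p) := by positivity
    have h1 : Real.exp (q * t) * r ≤ r₀ + C * k * D / (q - p) * Real.exp ((q - p) * t) := by
      linarith
    have h2 := mul_le_mul_of_nonneg_left h1 (Real.exp_pos (-q * t)).le
    rw [hcancel] at h2
    have e : Real.exp (-p * t) = Real.exp (-q * t) * Real.exp ((q - p) * t) := by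
      rw [← Real.exp_add]; ring_nf
    have h3 : Real.exp (-q * t) * r₀ ≤ Real.exp (-p * t) * r₀ := by gcongr
    calc r ≤ Real.exp (-q * t) * r₀ + C * k * D / (q - p) * Real.exp (-p * t) := by
          rw [e]; linarith
      _ ≤ Real.exp (-p * t) * r₀ + C * k * D / (q - p) * Real.exp (-p * t) := by linarith
      _ = _ := by ring
  · have hneg : q - p < 0 := sub_neg.2 hlt
    rw [min_eq_left hlt.le, abs_of_neg hneg]
    -- Now `B ≤ 0`: the exponential term is dropped, and `-B` supplies the constant.
    have hB : C * k * D / (q - p) ≤ 0 :=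
      div_nonpos_of_nonneg_of_nonpos (by positivity) hneg.le
    have h1 : Real.exp (q * t) * r ≤ r₀ - C * k * D / (q - p) := by
      have := mul_nonpos_of_nonpos_of_nonneg hB (Real.exp_pos ((q - p) * t)).le
      linarith
    have h2 := mul_le_mul_of_nonneg_left h1 (Real.exp_pos (-q * t)).le
    rw [hcancel] at h2
    refine h2.trans_eq ?_
    rw [div_neg]
    ring

end Systems

theorem theorem2
    {E₁ E₂ : Type*}
    [NormedAddCommGroup E₁] [NormedSpace ℝ E₁] [FiniteDimensional ℝ E₁]
    [NormedAddCommGroup E₂] [NormedSpace ℝ E₂] [FiniteDimensional ℝ E₂]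
    (f₁₁ f₁₂ : ℝ → E₁ → E₁) (H₁ : E₁ → ℝ)
    (f₂₁ f₂₂ : ℝ → E₁ → E₂ → E₂) (H₂ : E₂ → ℝ)
    (hH₁ : IsSwitchingManifold H₁) (hH₂ : IsSwitchingManifold H₂)
    (hf₁₁ : ∀ t : ℝ, 0 ≤ t → ContDiff ℝ 1 (f₁₁ t))
    (hf₁₂ : ∀ t : ℝ, 0 ≤ t → ContDiff ℝ 1 (f₁₂ t))
    (hf₂₁ : ∀ t : ℝ, 0 ≤ t → ContDiff ℝ 1 (fun ξ : E₁ × E₂ => f₂₁ t ξ.1 ξ.2))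
    (hf₂₂ : ∀ t : ℝ, 0 ≤ t → ContDiff ℝ 1 (fun ξ : E₁ × E₂ => f₂₂ t ξ.1 ξ.2))
    (q₁ q₂ c₁ c₂ : ℝ) (hq₁ : 0 < q₁) (hq₂ : 0 < q₂) (hc₁ : 0 < c₁) (hc₂ : 0 < c₂)
    (hII : ∀ ξ₁ : E₁,
      ContractionConditions (fun t => f₂₁ t ξ₁) (fun t => f₂₂ t ξ₁) H₂ q₁ q₂)
    (hJ₁ : ∀ t : ℝ, 0 ≤ t → ∀ (ξ₁ : E₁) (ξ₂ : E₂), 0 < H₂ ξ₂ →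
      ‖fderiv ℝ (fun ξ : E₁ => f₂₁ t ξ ξ₂) ξ₁‖ ≤ c₁)
    (hJ₂ : ∀ t : ℝ, 0 ≤ t → ∀ (ξ₁ : E₁) (ξ₂ : E₂), H₂ ξ₂ < 0 →
      ‖fderiv ℝ (fun ξ : E₁ => f₂₂ t ξ ξ₂) ξ₁‖ ≤ c₂) :
    (∀ p : ℝ, 0 < p → IncrementallyExpStable (filippovField f₁₁ f₁₂ H₁) p →
      (p ≠ min q₁ q₂ →
        DrivenIncrementallyExpStable f₁₁ f₁₂ H₁ f₂₁ f₂₂ H₂ (min (min q₁ q₂) p)) ∧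
      ∀ η : ℝ, 0 < η → η < min (min q₁ q₂) p →
        DrivenIncrementallyExpStable f₁₁ f₁₂ H₁ f₂₁ f₂₂ H₂ η) ∧
    (∀ p₁ p₂ : ℝ, 0 < p₁ → 0 < p₂ → ContractionConditions f₁₁ f₁₂ H₁ p₁ p₂ →
      (min p₁ p₂ ≠ min q₁ q₂ →
        DrivenIncrementallyExpStable f₁₁ f₁₂ H₁ f₂₁ f₂₂ H₂
          (min (min q₁ q₂) (min p₁ p₂))) ∧
      ∀ η : ℝ, 0 < η → η < min (min q₁ q₂) (min p₁ p₂) →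
        DrivenIncrementallyExpStable f₁₁ f₁₂ H₁ f₂₁ f₂₂ H₂ η) := by

  have main : ∀ p : ℝ, IncrementallyExpStable (filippovField f₁₁ f₁₂ H₁) p →
      (p ≠ min q₁ q₂ →
        DrivenIncrementallyExpStable f₁₁ f₁₂ H₁ f₂₁ f₂₂ H₂ (min (min q₁ q₂) p)) ∧
      ∀ η : ℝ, 0 < η → η < min (min q₁ q₂) p →
        DrivenIncrementallyExpStable f₁₁ f₁₂ H₁ f₂₁ f₂₂ H₂ η := by
    intro p hI
    refine ⟨drivenIncrementallyExpStable_of_ne hH₂ hf₂₁ hf₂₂ hc₁ hII hJ₁ hJ₂ hI,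
      fun η _ hη => ?_⟩
    have hηq : η < min q₁ q₂ := hη.trans_le (min_le_left _ _)
    -- A rate `p` implies the smaller rate `η`, and `η < q` avoids resonance.
    have h := drivenIncrementallyExpStable_of_ne hH₂ hf₂₁ hf₂₂ hc₁ hII hJ₁ hJ₂
      (hI.mono (hη.trans_le (min_le_right _ _)).le) hηq.ne
    rwa [min_eq_right hηq.le] at h
  exact ⟨fun p _ hI => main p hI,
    fun p₁ p₂ _ _ hI => main _ (hI.incrementallyExpStable hH₁ hf₁₁ hf₁₂)⟩
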